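/- Let $n\ge 1$, let $\Omega\subset\mathbb{R}^n$ be a nonempty open set, and let $f\in BV(\Omega)$, that is, $f\in L^1(\Omega)$ is real-valued and there are finite signed Borel measures $D_1f,\dots,D_nf$ on $\Omega$ (necessarily unique) such that $$\int_\Omega \varphi\, dD_if \;=\; -\int_\Omega \frac{\partial\varphi}{\partial x_i}\, f\,dx\qquad\text{for all }\varphi\in C_c^\infty(\Omega),\ 1\le i\le n .$$ Let $D_if = f_i^a\,dx + D_i^sf$ be the Lebesgue decomposition of $D_if$ with respect to Lebesgue measure, with $f_i^a\in L^1(\Omega)$ and $D_i^sf$ singular with respect to Lebesgue measure, and put $f^a=(f_1^a,\dots,f_n^a)$. 1. Let $1\le i\le n$, and let $g$ be any real-valued function on $\Omega$ with $g=f$ almost everywhere in $\Omega$ whose ordinary partial derivative $\partial g/\partial x_i$ exists (as a finite number) almost everywhere in $\Omega$. Then $\partial g/\partial x_i=f_i^a$ almost everywhere in $\Omega$. 2. Consequently, if $g=f$ almost everywhere in $\Omega$ and all the ordinary partial derivatives $\partial g/\partial x_1,\dots,\partial g/\partial x_n$ exist almost everywhere in $\Omega$, then $\nabla g:=(\partial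 g/\partial x_1,\dots,\partial g/\partial x_n)=f^a$ almost everywhere in $\Omega$. -/

import Mathlib

open MeasureTheory TopologicalSpace
open scoped Distributions

noncomputable section

namespace BVSpace

/-- The ordinary `i`-th partial derivative of `g : ℝⁿ → ℝ` exists at `x` (as a finite real number):
the function `t ↦ g (x + t eᵢ)` is differentiable at `t = 0`.
For `x` in an open set `Ω` this depends only on the values of `g` on `Ω`. -/
def PartialDerivExists {n : ℕ} (g : EuclideanSpace ℝ (Fin n) → ℝ) (i : Fin n)
    (x : EuclideanSpace ℝ (Fin n)) : Prop :=
  LineDifferentiableAt ℝ g x (EuclideanSpace.single i (1 : ℝ))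

/-- The ordinary `i`-th partial derivative `∂g/∂xᵢ (x)` of `g : ℝⁿ → ℝ`, that is, the derivative of
`t ↦ g (x + t eᵢ)` at `t = 0`. -/
def partialDeriv {n : ℕ} (g : EuclideanSpace ℝ (Fin n) → ℝ) (i : Fin n)
    (x : EuclideanSpace ℝ (Fin n)) : ℝ :=
  lineDeriv ℝ g x (EuclideanSpace.single i (1 : ℝ))

/-- The vector `∇g (x) = (∂g/∂x₁ (x), …, ∂g/∂xₙ (x))` of the ordinary partial derivatives.
No (total) differentiability of `g` is presupposed. -/
def grad {n : ℕ} (g : EuclideanSpace ℝ (Fin n) → ℝ) (x : EuclideanSpace ℝ (Fin n)) :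
    EuclideanSpace ℝ (Fin n) :=
  WithLp.toLp 2 fun i => partialDeriv g i x

/-- The integral `∫ φ dμ` of a real function against a finite signed measure, through the
Jordan decomposition `μ = μ⁺ - μ⁻`. -/
def signedIntegral {X : Type*} [MeasurableSpace X] (μ : SignedMeasure X) (φ : X → ℝ) : ℝ :=
  (∫ x, φ x ∂μ.toJordanDecomposition.posPart) - ∫ x, φ x ∂μ.toJordanDecomposition.negPart

/-- The finite signed measure `μ` is the `i`-th partial derivative of `f` on the open set `Ω` in the
sense of distributions: `∫ φ dμ = - ∫_Ω ∂φ/∂xᵢ f dx` for all `φ ∈ C_c^∞(Ω)`. A signed measure in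
`Ω` is here a signed Borel measure on `ℝⁿ` that vanishes on every Borel set disjoint from `Ω`.
(A `SignedMeasure` takes real values, so its total variation is finite.) -/
def IsDistribPartialDeriv {n : ℕ} (Ω : Opens (EuclideanSpace ℝ (Fin n)))
    (f : EuclideanSpace ℝ (Fin n) → ℝ) (i : Fin n)
    (μ : SignedMeasure (EuclideanSpace ℝ (Fin n))) : Prop :=
  (∀ A : Set (EuclideanSpace ℝ (Fin n)), MeasurableSet A →
      Disjoint A (Ω : Set (EuclideanSpace ℝ (Fin n))) → μ A = 0) ∧
    ∀ φ : 𝓓(Ω, ℝ), signedIntegral μ (fun x => φ x) =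
      -∫ x in (Ω : Set (EuclideanSpace ℝ (Fin n))), partialDeriv (fun y => φ y) i x * f x

/-- `f ∈ BV(Ω)`: `f ∈ L¹(Ω)` and every distributional partial derivative of `f` on `Ω` is a finite
signed measure in `Ω`. -/
structure IsBV {n : ℕ} (Ω : Opens (EuclideanSpace ℝ (Fin n)))
    (f : EuclideanSpace ℝ (Fin n) → ℝ) : Prop where
  integrableOn : IntegrableOn f (Ω : Set (EuclideanSpace ℝ (Fin n))) volume
  exists_deriv : ∀ i : Fin n, ∃ μ : SignedMeasure (EuclideanSpace ℝ (Fin n)),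
    IsDistribPartialDeriv Ω f i μ

/-- The measure `Dᵢ f`, for `f ∈ BV(Ω)`. It is determined by `f`, since a signed measure in `Ω` is
determined by its integrals against the functions in `C_c^∞(Ω)`. -/
def IsBV.D {n : ℕ} {Ω : Opens (EuclideanSpace ℝ (Fin n))}
    {f : EuclideanSpace ℝ (Fin n) → ℝ} (hf : IsBV Ω f) (i : Fin n) :
    SignedMeasure (EuclideanSpace ℝ (Fin n)) :=
  (hf.exists_deriv i).choose

theorem IsBV.D_spec {n : ℕ} {Ω : Opens (EuclideanSpace ℝ (Fin n))}
    {f : EuclideanSpace ℝ (Fin n) → ℝ} (hf : IsBV Ω f) (i : Fin n) :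
    IsDistribPartialDeriv Ω f i (hf.D i) :=
  (hf.exists_deriv i).choose_spec

/-- The density `fᵃ = (f₁ᵃ, …, fₙᵃ)` with respect to Lebesgue measure of the absolutely continuous
part `Dᵃ f` of `D f = (D₁ f, …, Dₙ f)`, for `f ∈ BV(Ω)`. -/
def IsBV.acDensity {n : ℕ} {Ω : Opens (EuclideanSpace ℝ (Fin n))}
    {f : EuclideanSpace ℝ (Fin n) → ℝ} (hf : IsBV Ω f) (x : EuclideanSpace ℝ (Fin n)) :
    EuclideanSpace ℝ (Fin n) :=
  WithLp.toLp 2 fun i => (hf.D i).rnDeriv volume x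

/-- The Lebesgue decomposition `Dᵢ f = Dᵢˢ f + fᵢᵃ dx`, with `Dᵢˢ f` singular with respect to
Lebesgue measure and `fᵢᵃ` integrable. -/
theorem IsBV.decomposition {n : ℕ} {Ω : Opens (EuclideanSpace ℝ (Fin n))}
    {f : EuclideanSpace ℝ (Fin n) → ℝ} (hf : IsBV Ω f) (i : Fin n) :
    hf.D i = (hf.D i).singularPart volume
        + (volume : Measure (EuclideanSpace ℝ (Fin n))).withDensityᵥ (fun x => hf.acDensity x i) ∧
      VectorMeasure.MutuallySingular ((hf.D i).singularPart volume)
        (volume : Measure (EuclideanSpace ℝ (Fin n))).toENNRealVectorMeasure ∧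
      Integrable (fun x => hf.acDensity x i) volume :=
  ⟨(SignedMeasure.singularPart_add_withDensity_rnDeriv_eq volume (hf.D i)).symm,
    SignedMeasure.mutuallySingular_singularPart (hf.D i) volume,
    SignedMeasure.integrable_rnDeriv (hf.D i) volume⟩

end BVSpace

end

/-!
The proof compares difference quotients with segment averages of `Dᵢ f`, in all dimensions at once
and without restricting `f` to lines. Extend `f` by zero outside `Ω` and put
`F_h x = (f (x + h eᵢ) - f x) / h` for `h > 0`.

* Along `h = 1 / (k + 1)` the quotients `F_h` converge to `∂g/∂xᵢ` almost everywhere in `Ω`: only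
  countably many translates of the null set `{g ≠ f}` are involved (`ae_tendsto_diffQuotient`).
* In the sense of distributions `F_h` is the average of `Dᵢ f` over the segments `[x, x + h eᵢ]`:
  `∫ F_h φ = ∫ φ_h dDᵢf`, where `φ_h` averages `φ` over the segments `[x - h eᵢ, x]`
  (`integral_diffQuotient_mul`). This holds because `φ_h` is again a test function, with
  `∂φ_h/∂xᵢ (x) = (φ x - φ (x - h eᵢ)) / h`.

The singular part of `Dᵢ f` lives on a Lebesgue null set, hence, up to a mass `ε`, on a compact null
set `K`. Let `O = Ω \ K`, and let `c` be continuous with compact support and within `ε` of `fᵢᵃ` in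
`L¹`. Test functions supported where the segment `[x, x + h eᵢ]` stays in `O` see almost nothing of
the singular part, so by duality (`integral_norm_le_of_integral_mul_le`) the `L¹` distance there
between `F_h` and the segment average of `c` is at most `2 ε` (`integral_norm_diffQuotient_sub_le`).
As `h → 0` these regions exhaust `O` and the averages of `c` converge to `c`, so Fatou's lemma gives
`∫_O |∂g/∂xᵢ - c| ≤ 2 ε` (`lintegral_partialDeriv_sub_le`). Since `K` is a null set,
`∫_Ω |∂g/∂xᵢ - fᵢᵃ| ≤ 3 ε` for every `ε > 0`.
-/

namespace BVSpace

open Set Filter Topology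
open scoped ENNReal ContDiff

/-! ### Averages over segments -/

section SegmentAverage

variable {E F : Type*} [NormedAddCommGroup E] [NormedSpace ℝ E]
  [NormedAddCommGroup F] [NormedSpace ℝ F]

/-- The average `∫₀¹ φ (x + s v) ds` of `φ` over the segment from `x` to `x + v`. -/
noncomputable def segmentAverage (φ : E → F) (v x : E) : F :=
  ∫ s in (0 : ℝ)..1, φ (x + s • v)

theorem continuous_segmentAverage_left {φ : E → F} (hφ : Continuous φ) (x : E) :
    Continuous fun v => segmentAverage φ v x :=
  intervalIntegral.continuous_parametric_intervalIntegral_of_continuous' (by fun_prop) 0 1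

theorem continuous_segmentAverage {φ : E → F} (hφ : Continuous φ) (v : E) :
    Continuous (segmentAverage φ v) :=
  intervalIntegral.continuous_parametric_intervalIntegral_of_continuous' (by fun_prop) 0 1

theorem segmentAverage_zero [CompleteSpace F] (φ : E → F) (x : E) :
    segmentAverage φ 0 x = φ x := by
  simp [segmentAverage]

theorem norm_segmentAverage_le {φ : E → F} {C : ℝ} (hC : ∀ x, ‖φ x‖ ≤ C) (v x : E) :
    ‖segmentAverage φ v x‖ ≤ C := by
  simpa [segmentAverage] using intervalIntegral.norm_integral_le_of_norm_le_const
    (a := 0) (b := 1) (f := fun s : ℝ => φ (x + s • v)) fun s _ => hC _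

theorem exists_ne_zero_of_segmentAverage_ne_zero {φ : E → F} {v x : E}
    (h : segmentAverage φ v x ≠ 0) : ∃ s ∈ Icc (0 : ℝ) 1, φ (x + s • v) ≠ 0 := by
  by_contra! H
  refine h (intervalIntegral.integral_zero_ae (ae_of_all _ fun s hs => H s ?_))
  rw [uIoc_of_le zero_le_one] at hs
  exact Ioc_subset_Icc_self hs

/-- The topological support of a segment average is contained in the compact set swept out by
moving the support of `φ` backwards along the segment. -/
theorem tsupport_segmentAverage_subset {φ : E → F} (hφ : HasCompactSupport φ) (v : E) :
    tsupport (segmentAverage φ v) ⊆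
      (fun p : E × ℝ => p.1 - p.2 • v) '' (tsupport φ ×ˢ Icc (0 : ℝ) 1) := by
  refine closure_minimal (fun x hx => ?_)
    ((hφ.isCompact.prod isCompact_Icc).image (by fun_prop)).isClosed
  obtain ⟨s, hs, hne⟩ := exists_ne_zero_of_segmentAverage_ne_zero hx
  exact ⟨(x + s • v, s), ⟨subset_tsupport _ hne, hs⟩, by simp⟩

theorem hasCompactSupport_segmentAverage {φ : E → F} (hφ : HasCompactSupport φ) (v : E) :
    HasCompactSupport (segmentAverage φ v) :=
  ((hφ.isCompact.prod isCompact_Icc).image (by fun_prop)).of_isClosed_subset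
    (isClosed_tsupport _) (tsupport_segmentAverage_subset hφ v)

/-- The fundamental theorem of calculus along the segment: averaging over it and then
differentiating in its direction gives the increment of the function. -/
theorem hasLineDerivAt_segmentAverage [CompleteSpace F] {φ : E → F} (hφ : Continuous φ)
    (v x : E) : HasLineDerivAt ℝ (segmentAverage φ v) (φ (x + v) - φ x) x v := by
  have hc : Continuous fun r : ℝ => φ (x + r • v) := by fun_prop
  -- shifting the integration variable moves the parameter into the endpoints of the integral
  have key : ∀ t : ℝ, segmentAverage φ v (x + t • v)
      = (∫ r in (0 : ℝ)..(t + 1), φ (x + r • v)) - ∫ r in (0 : ℝ)..t, φ (x + r • v) := by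
    intro t
    have h1 : ∀ s : ℝ, x + t • v + s • v = x + (t + s) • v := fun s => by
      rw [add_smul, add_assoc]
    simp only [segmentAverage, h1]
    rw [intervalIntegral.integral_comp_add_left (fun r => φ (x + r • v)) t, add_zero,
      intervalIntegral.integral_interval_sub_left (hc.intervalIntegrable _ _)
        (hc.intervalIntegrable _ _)]
  rw [HasLineDerivAt, funext key]
  have h2 : ∀ a : ℝ, HasDerivAt (fun u : ℝ => ∫ r in (0 : ℝ)..u, φ (x + r • v)) (φ (x + a • v)) a :=
    fun a => hc.integral_hasStrictDerivAt 0 a |>.hasDerivAt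
  have h3 := ((h2 (0 + 1)).comp_add_const 0 1).fun_sub (h2 0)
  simpa using h3

theorem hasFDerivAt_segmentAverage {φ : E → F} (hφ : ContDiff ℝ 1 φ)
    (hc : HasCompactSupport φ) (v x : E) :
    HasFDerivAt (segmentAverage φ v) (segmentAverage (fderiv ℝ φ) v x) x := by
  have hd : Continuous (fderiv ℝ φ) := hφ.continuous_fderiv one_ne_zero
  obtain ⟨C, hC⟩ := (hc.fderiv ℝ).exists_bound_of_continuous hd
  have hcont := hφ.continuous
  refine intervalIntegral.hasFDerivAt_integral_of_dominated_of_fderiv_le (𝕜 := ℝ)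
    (F' := fun y s => fderiv ℝ φ (y + s • v)) (s := univ) (bound := fun _ => C) univ_mem
    (Eventually.of_forall fun y => ?_) ?_ ?_ (ae_of_all _ fun t _ y _ => hC _)
    intervalIntegrable_const (ae_of_all _ fun t _ y _ => ?_)
  · exact (show Continuous fun s : ℝ => φ (y + s • v) by fun_prop).aestronglyMeasurable
  · exact (show Continuous fun s : ℝ => φ (x + s • v) by fun_prop).intervalIntegrable _ _
  · exact (show Continuous fun s : ℝ => fderiv ℝ φ (x + s • v) by fun_prop).aestronglyMeasurable
  · exact (hφ.differentiable one_ne_zero (y + t • v)).hasFDerivAt.comp y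
      ((hasFDerivAt_id y).add_const (t • v))

theorem contDiff_nat_segmentAverage.{u} (m : ℕ) {E F : Type u} [NormedAddCommGroup E]
    [NormedSpace ℝ E] [NormedAddCommGroup F] [NormedSpace ℝ F] {φ : E → F} (hφ : ContDiff ℝ m φ)
    (hc : HasCompactSupport φ) (v : E) : ContDiff ℝ m (segmentAverage φ v) := by
  induction m generalizing F with
  | zero => exact contDiff_zero.2 (continuous_segmentAverage hφ.continuous v)
  | succ m ih =>
    have h1 : ContDiff ℝ 1 φ := hφ.of_le (by norm_cast; omega)
    refine contDiff_succ_iff_hasFDerivAt.2 ⟨segmentAverage (fderiv ℝ φ) v, ih ?_ (hc.fderiv ℝ),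
      fun x => hasFDerivAt_segmentAverage h1 hc v x⟩
    exact hφ.fderiv_right (by norm_cast)

theorem contDiff_segmentAverage.{u} {E F : Type u} [NormedAddCommGroup E]
    [NormedSpace ℝ E] [NormedAddCommGroup F] [NormedSpace ℝ F] {φ : E → F} (hφ : ContDiff ℝ ∞ φ)
    (hc : HasCompactSupport φ) (v : E) : ContDiff ℝ ∞ (segmentAverage φ v) :=
  contDiff_infty.2 fun m => contDiff_nat_segmentAverage m (contDiff_infty.1 hφ m) hc v

/-- Averaging over backward segments is adjoint to averaging over forward segments. -/
theorem integral_segmentAverage_mul [FiniteDimensional ℝ E] [MeasurableSpace E] [BorelSpace E]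
    (ν : Measure E) [ν.IsAddHaarMeasure] {φ c : E → ℝ} (hφ : Continuous φ)
    (hφc : HasCompactSupport φ) (hc : Continuous c) (hcc : HasCompactSupport c) (v : E) :
    ∫ x, segmentAverage φ (-v) x * c x ∂ν = ∫ x, φ x * segmentAverage c v x ∂ν := by
  obtain ⟨C, hC⟩ := hφc.exists_bound_of_continuous hφ
  obtain ⟨D, hD⟩ := hcc.exists_bound_of_continuous hc
  have hc_int := hc.integrable_of_hasCompactSupport hcc (μ := ν)
  have hφ_int := hφ.integrable_of_hasCompactSupport hφc (μ := ν)
  have i1 : Integrable (Function.uncurry fun (x : E) (s : ℝ) => φ (x + s • (-v)) * c x)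
      (ν.prod (volume.restrict (Ioc (0 : ℝ) 1))) := by
    refine (hc_int.comp_fst _).bdd_mul (c := C) ?_ (ae_of_all _ fun p => hC _)
    exact (show Continuous fun p : E × ℝ => φ (p.1 + p.2 • (-v)) by fun_prop).aestronglyMeasurable
  have i2 : Integrable (Function.uncurry fun (x : E) (s : ℝ) => φ x * c (x + s • v))
      (ν.prod (volume.restrict (Ioc (0 : ℝ) 1))) := by
    refine (hφ_int.comp_fst _).mul_bdd (c := D) ?_ (ae_of_all _ fun p => hD _)
    exact (show Continuous fun p : E × ℝ => c (p.1 + p.2 • v) by fun_prop).aestronglyMeasurable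
  simp only [segmentAverage, intervalIntegral.integral_of_le zero_le_one, ← integral_mul_const,
    ← integral_const_mul]
  rw [integral_integral_swap i1, integral_integral_swap i2]
  congr 1 with s
  rw [← integral_add_right_eq_self (fun x => φ (x + s • (-v)) * c x) (s • v)]
  simp

end SegmentAverage

/-! ### Duality between `L¹` and test functions -/

section Duality

variable {E : Type*} [NormedAddCommGroup E] [NormedSpace ℝ E] [FiniteDimensional ℝ E]

theorem exists_contDiff_eq_one_of_isCompact {K U : Set E} (hK : IsCompact K) (hU : IsOpen U)
    (hKU : K ⊆ U) : ∃ φ : E → ℝ, ContDiff ℝ ∞ φ ∧ HasCompactSupport φ ∧ tsupport φ ⊆ U ∧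
      (∀ x ∈ K, φ x = 1) ∧ ∀ x, φ x ∈ Icc (0 : ℝ) 1 := by
  obtain ⟨L, hL, hKL, hLU⟩ := exists_compact_between hK hU hKU
  obtain ⟨φ, h1, h0, h01⟩ := exists_contMDiffMap_one_nhds_of_subset_interior
    (modelWithCornersSelf ℝ E) (n := (⊤ : ℕ∞)) hK.isClosed hKL
  have hsupp : Function.support φ ⊆ L := fun x hx => by
    by_contra hxL
    exact hx (h0 x hxL)
  exact ⟨φ, φ.contMDiff.contDiff, HasCompactSupport.intro hL h0,
    (closure_minimal hsupp hL.isClosed).trans hLU, fun x hx => h1.self_of_nhdsSet x hx, h01⟩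

/-- The `L¹` norm on an open set is dominated by any bound for the pairing with smooth compactly
supported functions of absolute value at most one. -/
theorem integral_norm_le_of_integral_mul_le [MeasurableSpace E] [BorelSpace E]
    {ν : Measure E} {u : E → ℝ} (hu : Integrable u ν) {W : Set E}
    (hW : IsOpen W) {C : ℝ}
    (h : ∀ φ : E → ℝ, ContDiff ℝ ∞ φ → HasCompactSupport φ → tsupport φ ⊆ W →
      (∀ x, |φ x| ≤ 1) → ∫ x, u x * φ x ∂ν ≤ C) :
    ∫ x in W, ‖u x‖ ∂ν ≤ C := by
  -- pass to a strongly measurable representative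
  wlog hm : StronglyMeasurable u generalizing u
  · have hae := hu.1.ae_eq_mk
    have := this (u := hu.1.mk u) (hu.congr hae) (fun φ h1 h2 h3 h4 => ?_) hu.1.stronglyMeasurable_mk
    · refine le_of_eq_of_le (integral_congr_ae (ae_restrict_of_ae ?_)) this
      filter_upwards [hae] with x hx using by rw [hx]
    · refine le_of_eq_of_le (integral_congr_ae ?_) (h φ h1 h2 h3 h4)
      filter_upwards [hae] with x hx using by rw [hx]
  refine le_of_forall_pos_le_add fun ε hε => ?_
  -- the finite measure with density `|u|`
  have hfin : ∫⁻ x, ‖u x‖ₑ ∂ν ≠ ⊤ := hu.2.ne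
  set τ : Measure E := ν.withDensity fun x => ‖u x‖ₑ
  have : IsFiniteMeasure τ := isFiniteMeasure_withDensity hfin
  have hPm : MeasurableSet (W ∩ {x | 0 < u x}) :=
    hW.measurableSet.inter (measurableSet_lt measurable_const hm.measurable)
  have hNm : MeasurableSet (W ∩ {x | u x < 0}) :=
    hW.measurableSet.inter (measurableSet_lt hm.measurable measurable_const)
  have hε' : ENNReal.ofReal (ε / 4) ≠ 0 := by simpa using hε
  obtain ⟨K₁, hK₁, hK₁c, hτ₁⟩ := hPm.exists_isCompact_sdiff_lt (μ := τ) (measure_ne_top _ _) hε'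
  obtain ⟨K₂, hK₂, hK₂c, hτ₂⟩ := hNm.exists_isCompact_sdiff_lt (μ := τ) (measure_ne_top _ _) hε'
  have hdis : Disjoint K₁ K₂ := by
    rw [Set.disjoint_left]
    exact fun x h1 h2 => lt_asymm (show 0 < u x from (hK₁ h1).2) (hK₂ h2).2
  obtain ⟨U₁, U₂, hU₁, hU₂, hKU₁, hKU₂, hUU⟩ := SeparatedNhds.of_isCompact_isCompact hK₁c hK₂c hdis
  obtain ⟨φ₁, hs₁, hc₁, ht₁, h1₁, hb₁⟩ := exists_contDiff_eq_one_of_isCompact hK₁c (hU₁.inter hW)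
    fun x hx => ⟨hKU₁ hx, (hK₁ hx).1⟩
  obtain ⟨φ₂, hs₂, hc₂, ht₂, h1₂, hb₂⟩ := exists_contDiff_eq_one_of_isCompact hK₂c (hU₂.inter hW)
    fun x hx => ⟨hKU₂ hx, (hK₂ hx).1⟩
  have hz₁ : ∀ x, x ∉ U₁ ∩ W → φ₁ x = 0 := fun x hx => image_eq_zero_of_notMem_tsupport
    fun h => hx (ht₁ h)
  have hz₂ : ∀ x, x ∉ U₂ ∩ W → φ₂ x = 0 := fun x hx => image_eq_zero_of_notMem_tsupport
    fun h => hx (ht₂ h)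
  have hts : tsupport (φ₁ - φ₂) ⊆ tsupport φ₁ ∪ tsupport φ₂ := tsupport_sub _ _
  have hcs : HasCompactSupport (φ₁ - φ₂) :=
    (hc₁.isCompact.union hc₂.isCompact).of_isClosed_subset (isClosed_tsupport _) hts
  have hb : ∀ x, |(φ₁ - φ₂) x| ≤ 1 := fun x => by
    have h1 := hb₁ x
    have h2 := hb₂ x
    rw [Pi.sub_apply, abs_le]
    constructor <;> linarith [h1.1, h1.2, h2.1, h2.2]
  have hle := h (φ₁ - φ₂) (hs₁.sub hs₂) hcs
    (hts.trans (union_subset (ht₁.trans inter_subset_right) (ht₂.trans inter_subset_right))) hb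
  set R : Set E := ((W ∩ {x | 0 < u x}) \ K₁) ∪ ((W ∩ {x | u x < 0}) \ K₂)
  have hRm : MeasurableSet R := (hPm.diff hK₁c.measurableSet).union (hNm.diff hK₂c.measurableSet)
  have hRi : ∫ x in R, ‖u x‖ ∂ν ≤ ε / 2 := by
    have h1 : ∫⁻ x in R, ‖u x‖ₑ ∂ν ≤ ENNReal.ofReal (ε / 2) := by
      rw [← withDensity_apply _ hRm]
      refine (measure_union_le _ _).trans ((add_le_add hτ₁.le hτ₂.le).trans_eq ?_)
      rw [← ENNReal.ofReal_add (by positivity) (by positivity)]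
      congr 1
      ring
    rw [integral_norm_eq_lintegral_enorm hu.1.restrict]
    exact ENNReal.toReal_le_of_le_ofReal (by positivity) h1
  -- the test function equals the sign of `u` except on `R`, and vanishes off `W`
  have hpt : ∀ x, W.indicator (fun x => ‖u x‖) x - 2 * R.indicator (fun x => ‖u x‖) x
      ≤ u x * (φ₁ - φ₂) x := by
    intro x
    have hx2 : -‖u x‖ ≤ u x * (φ₁ - φ₂) x := by
      have : |u x * (φ₁ - φ₂) x| ≤ ‖u x‖ := by
        rw [abs_mul, Real.norm_eq_abs]
        exact mul_le_of_le_one_right (abs_nonneg _) (hb x)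
      exact (abs_le.1 this).1
    by_cases hxW : x ∈ W
    · rw [indicator_of_mem hxW]
      by_cases hxR : x ∈ R
      · rw [indicator_of_mem hxR]
        linarith
      · rw [indicator_of_notMem hxR]
        rcases lt_trichotomy (u x) 0 with hneg | h0 | hpos
        · have hxK : x ∈ K₂ := by
            by_contra hK
            exact hxR (Or.inr ⟨⟨hxW, hneg⟩, hK⟩)
          have : φ₁ x = 0 := hz₁ x fun hx => Set.disjoint_left.1 hUU hx.1 (hKU₂ hxK)
          rw [Pi.sub_apply, this, h1₂ x hxK, Real.norm_eq_abs, abs_of_neg hneg]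
          linarith
        · simp [h0]
        · have hxK : x ∈ K₁ := by
            by_contra hK
            exact hxR (Or.inl ⟨⟨hxW, hpos⟩, hK⟩)
          have : φ₂ x = 0 := hz₂ x fun hx => Set.disjoint_left.1 hUU (hKU₁ hxK) hx.1
          rw [Pi.sub_apply, this, h1₁ x hxK, Real.norm_eq_abs, abs_of_pos hpos]
          linarith
    · have hxR : x ∉ R := fun h => hxW (h.elim (fun h => h.1.1) fun h => h.1.1)
      rw [indicator_of_notMem hxW, indicator_of_notMem hxR, Pi.sub_apply,
        hz₁ x fun h => hxW h.2, hz₂ x fun h => hxW h.2]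
      simp
  have hiW := hu.norm.indicator hW.measurableSet
  have hiR := hu.norm.indicator hRm
  have hiφ : Integrable (fun x => u x * (φ₁ - φ₂) x) ν :=
    hu.mul_bdd (c := 1) (hs₁.sub hs₂).continuous.aestronglyMeasurable (ae_of_all _ hb)
  have hint := integral_mono (hiW.sub (hiR.const_mul 2)) hiφ hpt
  rw [integral_sub' hiW (hiR.const_mul 2), integral_const_mul, integral_indicator hW.measurableSet,
    integral_indicator hRm] at hint
  linarith

end Duality

/-! ### Lebesgue decomposition of integrals against signed measures -/

section SignedMeasure

variable {X : Type*} [MeasurableSpace X]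

/-- The sum of the parts of `μ⁺` and `μ⁻` that are singular with respect to `ν`: a finite measure
that bounds integrals against the singular part of `μ`. -/
noncomputable def singularVariation (μ : SignedMeasure X) (ν : Measure X) : Measure X :=
  μ.toJordanDecomposition.posPart.singularPart ν + μ.toJordanDecomposition.negPart.singularPart ν

instance (μ : SignedMeasure X) (ν : Measure X) : IsFiniteMeasure (singularVariation μ ν) := by
  unfold singularVariation
  infer_instance

theorem mutuallySingular_singularVariation (μ : SignedMeasure X) (ν : Measure X) :
    singularVariation μ ν ⟂ₘ ν :=
  (Measure.mutuallySingular_singularPart _ _).add_left (Measure.mutuallySingular_singularPart _ _)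

theorem integral_eq_integral_singularPart_add (p ν : Measure X) [IsFiniteMeasure p] [SigmaFinite ν]
    {φ : X → ℝ} (hφ : Integrable φ p) :
    ∫ x, φ x ∂p = (∫ x, φ x ∂(p.singularPart ν)) + ∫ x, φ x * (p.rnDeriv ν x).toReal ∂ν := by
  have hp := Measure.haveLebesgueDecomposition_add p ν
  have h1 : Integrable φ (p.singularPart ν) := hφ.mono_measure (Measure.singularPart_le p ν)
  have h2 : Integrable φ (ν.withDensity (p.rnDeriv ν)) :=
    hφ.mono_measure (Measure.withDensity_rnDeriv_le p ν)
  conv_lhs => rw [hp]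
  rw [integral_add_measure h1 h2, integral_withDensity_eq_integral_toReal_smul
    (Measure.measurable_rnDeriv p ν) (Measure.rnDeriv_lt_top p ν)]
  simp only [smul_eq_mul, mul_comm]

/-- Integration against `μ` differs from integration against its density only by what the singular
part contributes on the set where the integrand lives. -/
theorem abs_signedIntegral_sub_le (μ : SignedMeasure X) (ν : Measure X) [SigmaFinite ν]
    {φ : X → ℝ} (hφ : Measurable φ) (hb : ∀ x, |φ x| ≤ 1) {O : Set X}
    (h0 : ∀ x ∉ O, φ x = 0) :
    |signedIntegral μ φ - ∫ x, φ x * μ.rnDeriv ν x ∂ν| ≤ (singularVariation μ ν).real O := by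
  have hi : ∀ (p : Measure X) [IsFiniteMeasure p], Integrable φ p := fun p _ =>
    Integrable.of_bound hφ.aestronglyMeasurable 1 (ae_of_all _ hb)
  have hd : ∀ (p : Measure X) [IsFiniteMeasure p],
      Integrable (fun x => φ x * (p.rnDeriv ν x).toReal) ν := fun p _ =>
    Integrable.bdd_mul (c := 1) Measure.integrable_toReal_rnDeriv hφ.aestronglyMeasurable
      (ae_of_all _ hb)
  have hs : ∀ (p : Measure X) [IsFiniteMeasure p], |∫ x, φ x ∂p| ≤ p.real O := by
    intro p _
    rw [← setIntegral_eq_integral_of_forall_compl_eq_zero h0]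
    refine (norm_setIntegral_le_of_norm_le_const (C := 1) (f := φ) (measure_lt_top p O)
      fun x _ => hb x).trans_eq (one_mul _)
  have key : signedIntegral μ φ - ∫ x, φ x * μ.rnDeriv ν x ∂ν
      = ∫ x, φ x ∂(μ.toJordanDecomposition.posPart.singularPart ν)
        - ∫ x, φ x ∂(μ.toJordanDecomposition.negPart.singularPart ν) := by
    rw [signedIntegral,
      integral_eq_integral_singularPart_add μ.toJordanDecomposition.posPart ν (hi _),
      integral_eq_integral_singularPart_add μ.toJordanDecomposition.negPart ν (hi _)]
    simp only [SignedMeasure.rnDeriv_def, mul_sub]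
    rw [integral_sub (hd _) (hd _)]
    ring
  rw [key, singularVariation, measureReal_add_apply]
  exact (abs_sub _ _).trans (add_le_add (hs _) (hs _))

end SignedMeasure

/-! ### Difference quotients of functions of bounded variation -/

section DifferenceQuotient

variable {n : ℕ} {Ω : Opens (EuclideanSpace ℝ (Fin n))} {f : EuclideanSpace ℝ (Fin n) → ℝ}
  {i : Fin n} {μ : SignedMeasure (EuclideanSpace ℝ (Fin n))}

/-- The difference quotient `(f (x + h eᵢ) - f x) / h`, for `f` extended by zero outside `Ω`. -/
noncomputable def diffQuotient (Ω : Opens (EuclideanSpace ℝ (Fin n)))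
    (f : EuclideanSpace ℝ (Fin n) → ℝ) (i : Fin n) (h : ℝ) (x : EuclideanSpace ℝ (Fin n)) : ℝ :=
  h⁻¹ * ((Ω : Set (EuclideanSpace ℝ (Fin n))).indicator f (x + h • EuclideanSpace.single i 1)
    - (Ω : Set (EuclideanSpace ℝ (Fin n))).indicator f x)

theorem integrable_diffQuotient
    (hf : IntegrableOn f (Ω : Set (EuclideanSpace ℝ (Fin n))) volume) (h : ℝ) :
    Integrable (diffQuotient Ω f i h) volume := by
  have hf' := hf.integrable_indicator Ω.isOpen.measurableSet
  exact ((hf'.comp_add_right _).sub hf').const_mul _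

theorem partialDeriv_segmentAverage {φ : EuclideanSpace ℝ (Fin n) → ℝ} (hφ : Continuous φ)
    {h : ℝ} (hh : h ≠ 0) (x : EuclideanSpace ℝ (Fin n)) :
    partialDeriv (segmentAverage φ (-(h • EuclideanSpace.single i 1))) i x =
      -(h⁻¹ * (φ (x - h • EuclideanSpace.single i 1) - φ x)) := by
  have h1 := (hasLineDerivAt_segmentAverage hφ (-(h • EuclideanSpace.single i (1 : ℝ))) x).smul
    (-h⁻¹)
  have h2 : (-h⁻¹) • -(h • EuclideanSpace.single i (1 : ℝ)) = EuclideanSpace.single i (1 : ℝ) := by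
    rw [smul_neg, neg_smul, neg_neg, smul_smul, inv_mul_cancel₀ hh, one_smul]
  rw [h2] at h1
  rw [partialDeriv, h1.lineDeriv]
  simp [sub_eq_add_neg]

/-- In the sense of distributions the difference quotient of `f` is the average of `Dᵢ f` over
segments: testing it against `φ` amounts to testing `Dᵢ f` against the backward averages of `φ`. -/
theorem integral_diffQuotient_mul
    (hf : IntegrableOn f (Ω : Set (EuclideanSpace ℝ (Fin n))) volume)
    (hμ : IsDistribPartialDeriv Ω f i μ) {h : ℝ} (hh : h ≠ 0)
    {φ : EuclideanSpace ℝ (Fin n) → ℝ} (hφ : ContDiff ℝ ∞ φ) (hφc : HasCompactSupport φ)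
    (hφΩ : tsupport (segmentAverage φ (-(h • EuclideanSpace.single i 1))) ⊆ Ω) :
    ∫ x, diffQuotient Ω f i h x * φ x =
      signedIntegral μ (segmentAverage φ (-(h • EuclideanSpace.single i 1))) := by
  obtain ⟨C, hC⟩ := hφc.exists_bound_of_continuous hφ.continuous
  have hf' := hf.integrable_indicator Ω.isOpen.measurableSet
  have hcont := hφ.continuous
  let ψ : 𝓓(Ω, ℝ) := ⟨_, contDiff_segmentAverage hφ hφc _, hasCompactSupport_segmentAverage hφc _,
    hφΩ⟩
  have hψ := hμ.2 ψ
  change signedIntegral μ (segmentAverage φ _) =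
    -∫ x in _, partialDeriv (segmentAverage φ (-(h • EuclideanSpace.single i 1))) i x * f x at hψ
  simp only [partialDeriv_segmentAverage hcont hh] at hψ
  rw [hψ]
  set v : EuclideanSpace ℝ (Fin n) := h • EuclideanSpace.single i 1 with hv
  set f' : EuclideanSpace ℝ (Fin n) → ℝ :=
    (Ω : Set (EuclideanSpace ℝ (Fin n))).indicator f with hf'def
  have i1 : Integrable (fun x => f' x * φ x) :=
    hf'.mul_bdd (c := C) hcont.aestronglyMeasurable (ae_of_all _ hC)
  have i2 : Integrable (fun x => f' x * φ (x - v)) :=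
    hf'.mul_bdd (c := C) (show Continuous fun x => φ (x - v) by fun_prop).aestronglyMeasurable
      (ae_of_all _ fun x => hC _)
  have i3 : Integrable (fun x => f' (x + v) * φ x) := by
    simpa using i2.comp_add_right v
  have e3 : ∫ x, f' (x + v) * φ x = ∫ x, f' x * φ (x - v) := by
    rw [← integral_add_right_eq_self (fun x => f' x * φ (x - v)) v]
    simp
  have lhs : ∫ x, diffQuotient Ω f i h x * φ x
      = h⁻¹ * ((∫ x, f' (x + v) * φ x) - ∫ x, f' x * φ x) := by
    rw [← integral_sub i3 i1, ← integral_const_mul]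
    congr 1 with x
    simp only [diffQuotient, ← hv, ← hf'def]
    ring
  have rhs : (∫ x in (Ω : Set (EuclideanSpace ℝ (Fin n))), -(h⁻¹ * (φ (x - v) - φ x)) * f x)
      = -(h⁻¹ * ((∫ x, f' x * φ (x - v)) - ∫ x, f' x * φ x)) := by
    rw [← integral_sub i2 i1, ← integral_const_mul, ← integral_neg,
      ← integral_indicator Ω.isOpen.measurableSet]
    congr 1 with x
    rw [hf'def]
    by_cases hx : x ∈ (Ω : Set (EuclideanSpace ℝ (Fin n)))
    · simp only [indicator_of_mem hx]
      ring
    · simp only [indicator_of_notMem hx]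
      ring
  rw [lhs, rhs, e3, neg_neg]

/-- The points from which the segment to `x + v` stays inside `O`. -/
def segmentInterior {E : Type*} [AddCommGroup E] [Module ℝ E] (O : Set E) (v : E) : Set E :=
  {x | ∀ s ∈ Icc (0 : ℝ) 1, x + s • v ∈ O}

theorem isOpen_segmentInterior {E : Type*} [NormedAddCommGroup E] [NormedSpace ℝ E] {O : Set E}
    (hO : IsOpen O) (v : E) : IsOpen (segmentInterior O v) := by
  refine isOpen_iff_mem_nhds.2 fun x hx => isCompact_Icc.eventually_forall_of_forall_eventually
    fun s hs => ?_
  have hc : Continuous fun p : E × ℝ => p.1 + p.2 • v := by fun_prop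
  exact hc.continuousAt.eventually_mem (hO.mem_nhds (hx s hs))

theorem eventually_mem_segmentInterior {E : Type*} [NormedAddCommGroup E] [NormedSpace ℝ E]
    {O : Set E} (hO : IsOpen O) {x : E} (hx : x ∈ O) :
    ∀ᶠ v in 𝓝 (0 : E), x ∈ segmentInterior O v := by
  refine isCompact_Icc.eventually_forall_of_forall_eventually fun s hs => ?_
  have hc : Continuous fun p : E × ℝ => x + p.2 • p.1 := by fun_prop
  exact hc.continuousAt.eventually_mem (hO.mem_nhds (by simpa using hx))

/-- Difference quotients are `L¹` close to the segment averages of `c`, on an open set `O` that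
carries little of the singular part of `Dᵢ f`, if `c` is close to the density of `Dᵢ f`. -/
theorem integral_norm_diffQuotient_sub_le
    (hf : IntegrableOn f (Ω : Set (EuclideanSpace ℝ (Fin n))) volume)
    (hμ : IsDistribPartialDeriv Ω f i μ) {h : ℝ} (hh : h ≠ 0)
    {O : Set (EuclideanSpace ℝ (Fin n))} (hO : IsOpen O) (hOΩ : O ⊆ Ω)
    {c : EuclideanSpace ℝ (Fin n) → ℝ} (hc : Continuous c) (hcc : HasCompactSupport c) :
    ∫ x in segmentInterior O (h • EuclideanSpace.single i 1),
        ‖diffQuotient Ω f i h x - segmentAverage c (h • EuclideanSpace.single i 1) x‖ ≤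
      (∫ x, ‖μ.rnDeriv volume x - c x‖) + (singularVariation μ volume).real O := by
  have hFi := integrable_diffQuotient (i := i) hf h
  set v : EuclideanSpace ℝ (Fin n) := h • EuclideanSpace.single i 1 with hv
  have hci : Integrable (segmentAverage c v) :=
    (continuous_segmentAverage hc v).integrable_of_hasCompactSupport
      (hasCompactSupport_segmentAverage hcc v)
  have hc_int : Integrable c := hc.integrable_of_hasCompactSupport hcc
  have hu_int := SignedMeasure.integrable_rnDeriv μ volume
  refine integral_norm_le_of_integral_mul_le (hFi.sub hci) (isOpen_segmentInterior hO v)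
    fun φ hφ hφc hφW hφb => ?_
  have hψc := continuous_segmentAverage hφ.continuous (-v)
  have hψb : ∀ x, |segmentAverage φ (-v) x| ≤ 1 := norm_segmentAverage_le (φ := φ) hφb (-v)
  have hψO : tsupport (segmentAverage φ (-v)) ⊆ O := by
    refine (tsupport_segmentAverage_subset hφc (-v)).trans ?_
    rintro _ ⟨⟨y, s⟩, ⟨hy, hs⟩, rfl⟩
    simpa using hφW hy s hs
  have hsing := abs_signedIntegral_sub_le μ volume hψc.measurable hψb
    fun x hx => image_eq_zero_of_notMem_tsupport fun hx' => hx (hψO hx')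
  have i1 : Integrable (fun x => segmentAverage φ (-v) x * μ.rnDeriv volume x) :=
    hu_int.bdd_mul (c := 1) hψc.aestronglyMeasurable (ae_of_all _ hψb)
  have i2 : Integrable (fun x => segmentAverage φ (-v) x * c x) :=
    hc_int.bdd_mul (c := 1) hψc.aestronglyMeasurable (ae_of_all _ hψb)
  have i3 : Integrable (fun x => diffQuotient Ω f i h x * φ x) :=
    hFi.mul_bdd (c := 1) hφ.continuous.aestronglyMeasurable (ae_of_all _ hφb)
  have i4 : Integrable (fun x => φ x * segmentAverage c v x) :=
    hci.bdd_mul (c := 1) hφ.continuous.aestronglyMeasurable (ae_of_all _ hφb)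
  have hle : (∫ x, segmentAverage φ (-v) x * μ.rnDeriv volume x)
      - ∫ x, segmentAverage φ (-v) x * c x ≤ ∫ x, ‖μ.rnDeriv volume x - c x‖ := by
    rw [← integral_sub i1 i2]
    refine integral_mono (i1.sub i2) (hu_int.sub hc_int).norm fun x => ?_
    simp only [← mul_sub]
    refine (le_abs_self _).trans ?_
    rw [abs_mul]
    exact mul_le_of_le_one_left (abs_nonneg _) (hψb x)
  calc ∫ x, (diffQuotient Ω f i h - segmentAverage c v) x * φ x
      = (∫ x, diffQuotient Ω f i h x * φ x) - ∫ x, φ x * segmentAverage c v x := by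
        rw [← integral_sub i3 i4]
        congr 1 with x
        simp only [Pi.sub_apply]
        ring
    _ = signedIntegral μ (segmentAverage φ (-v)) - ∫ x, segmentAverage φ (-v) x * c x := by
        rw [integral_diffQuotient_mul hf hμ hh hφ hφc (hψO.trans hOΩ),
          integral_segmentAverage_mul volume hφ.continuous hφc hc hcc v]
    _ ≤ _ := by linarith [(abs_le.1 hsing).2]

/-- Sampling along a sequence of increments makes the pointwise derivative of `g` visible through
`f` alone, because countably many translates of a null set form a null set. -/
theorem ae_tendsto_diffQuotient {g : EuclideanSpace ℝ (Fin n) → ℝ}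
    (hgf : ∀ᵐ x ∂(volume.restrict (Ω : Set (EuclideanSpace ℝ (Fin n)))), g x = f x)
    (hg : ∀ᵐ x ∂(volume.restrict (Ω : Set (EuclideanSpace ℝ (Fin n)))), PartialDerivExists g i x)
    {t : ℕ → ℝ} (ht : Tendsto t atTop (𝓝[≠] 0)) :
    ∀ᵐ x ∂(volume.restrict (Ω : Set (EuclideanSpace ℝ (Fin n)))),
      Tendsto (fun k => diffQuotient Ω f i (t k) x) atTop (𝓝 (partialDeriv g i x)) := by
  have hgf' := (ae_restrict_iff' Ω.isOpen.measurableSet).1 hgf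
  have hshift : ∀ᵐ x ∂(volume.restrict (Ω : Set (EuclideanSpace ℝ (Fin n)))), ∀ k,
      x + t k • EuclideanSpace.single i (1 : ℝ) ∈ (Ω : Set (EuclideanSpace ℝ (Fin n))) →
      g (x + t k • EuclideanSpace.single i (1 : ℝ)) =
        f (x + t k • EuclideanSpace.single i (1 : ℝ)) :=
    ae_restrict_of_ae (ae_all_iff.2 fun k =>
      (measurePreserving_add_right volume (t k • EuclideanSpace.single i (1 : ℝ))
        ).quasiMeasurePreserving.ae hgf')
  filter_upwards [hgf, hg, hshift, ae_restrict_mem Ω.isOpen.measurableSet] with x hx hdx hsx hxΩ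
  have hlim := hdx.hasLineDerivAt.tendsto_slope_zero.comp ht
  refine hlim.congr' ?_
  have hc : Continuous fun s : ℝ => x + s • EuclideanSpace.single i (1 : ℝ) := by fun_prop
  have hev : ∀ᶠ s in 𝓝 (0 : ℝ), x + s • EuclideanSpace.single i (1 : ℝ) ∈
      (Ω : Set (EuclideanSpace ℝ (Fin n))) :=
    hc.continuousAt.eventually_mem (Ω.isOpen.mem_nhds (by simpa using hxΩ))
  filter_upwards [(ht.mono_right nhdsWithin_le_nhds).eventually hev] with k hk
  simp only [Function.comp_apply, smul_eq_mul, diffQuotient, indicator_of_mem hk,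
    indicator_of_mem hxΩ, hsx k hk, hx]

/-- Fatou's lemma transfers the bound for difference quotients to the pointwise derivative. -/
theorem lintegral_partialDeriv_sub_le
    (hf : IntegrableOn f (Ω : Set (EuclideanSpace ℝ (Fin n))) volume)
    (hμ : IsDistribPartialDeriv Ω f i μ) {g : EuclideanSpace ℝ (Fin n) → ℝ}
    (hgf : ∀ᵐ x ∂(volume.restrict (Ω : Set (EuclideanSpace ℝ (Fin n)))), g x = f x)
    (hg : ∀ᵐ x ∂(volume.restrict (Ω : Set (EuclideanSpace ℝ (Fin n)))), PartialDerivExists g i x)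
    {O : Set (EuclideanSpace ℝ (Fin n))} (hO : IsOpen O) (hOΩ : O ⊆ Ω)
    {c : EuclideanSpace ℝ (Fin n) → ℝ} (hc : Continuous c) (hcc : HasCompactSupport c) :
    ∫⁻ x in O, ‖partialDeriv g i x - c x‖ₑ ≤
      ENNReal.ofReal ((∫ x, ‖μ.rnDeriv volume x - c x‖) + (singularVariation μ volume).real O) := by
  let t : ℕ → ℝ := fun k => 1 / ((k : ℝ) + 1)
  have ht0 : ∀ k, t k ≠ 0 := fun k => (Nat.one_div_pos_of_nat).ne'
  have ht : Tendsto t atTop (𝓝 0) := tendsto_one_div_add_atTop_nhds_zero_nat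
  have ht' : Tendsto t atTop (𝓝[≠] 0) :=
    tendsto_nhdsWithin_iff.2 ⟨ht, Eventually.of_forall ht0⟩
  let v : ℕ → EuclideanSpace ℝ (Fin n) := fun k => t k • EuclideanSpace.single i 1
  have hv : Tendsto v atTop (𝓝 0) := by
    simpa using ht.smul_const (EuclideanSpace.single i (1 : ℝ))
  let D : ℕ → EuclideanSpace ℝ (Fin n) → ℝ :=
    fun k x => diffQuotient Ω f i (t k) x - segmentAverage c (v k) x
  have hD : ∀ k, Integrable (D k) := fun k => (integrable_diffQuotient hf (t k)).sub
    ((continuous_segmentAverage hc _).integrable_of_hasCompactSupport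
      (hasCompactSupport_segmentAverage hcc _))
  let G : ℕ → EuclideanSpace ℝ (Fin n) → ℝ≥0∞ :=
    fun k => (segmentInterior O (v k)).indicator fun x => ‖D k x‖ₑ
  have hWm : ∀ k, MeasurableSet (segmentInterior O (v k)) := fun k =>
    (isOpen_segmentInterior hO _).measurableSet
  have hGm : ∀ k, AEMeasurable (G k) := fun k => (hD k).1.enorm.indicator (hWm k)
  have hGle : ∀ k, ∫⁻ x in O, G k x ≤ ENNReal.ofReal
      ((∫ x, ‖μ.rnDeriv volume x - c x‖) + (singularVariation μ volume).real O) := by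
    intro k
    refine (setLIntegral_le_lintegral _ _).trans ?_
    rw [lintegral_indicator (hWm k), ← ofReal_integral_norm_eq_lintegral_enorm (hD k).restrict]
    exact ENNReal.ofReal_le_ofReal
      (integral_norm_diffQuotient_sub_le hf hμ (ht0 k) hO hOΩ hc hcc)
  have hlim : ∀ᵐ x ∂(volume.restrict O),
      ‖partialDeriv g i x - c x‖ₑ = liminf (fun k => G k x) atTop := by
    filter_upwards [ae_restrict_of_ae_restrict_of_subset hOΩ (ae_tendsto_diffQuotient hgf hg ht'),
      ae_restrict_mem hO.measurableSet] with x hx hxO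
    have hcx : Tendsto (fun k => segmentAverage c (v k) x) atTop (𝓝 (c x)) := by
      have := (continuous_segmentAverage_left hc x).tendsto 0
      rw [segmentAverage_zero] at this
      exact this.comp hv
    refine (Tendsto.liminf_eq (((hx.sub hcx).enorm).congr' ?_)).symm
    filter_upwards [hv.eventually (eventually_mem_segmentInterior hO hxO)] with k hk
    simp only [G, D, indicator_of_mem hk]
  calc ∫⁻ x in O, ‖partialDeriv g i x - c x‖ₑ
      = ∫⁻ x in O, liminf (fun k => G k x) atTop := lintegral_congr_ae hlim
    _ ≤ liminf (fun k => ∫⁻ x in O, G k x) atTop :=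
        lintegral_liminf_le' fun k => (hGm k).restrict
    _ ≤ _ := liminf_le_of_le (by isBoundedDefault) fun b hb => by
        obtain ⟨k, hk⟩ := hb.exists
        exact hk.trans (hGle k)

/-- A compact null set that carries almost all of the singular part is removed from `Ω`, and the
density is approximated in `L¹` by a continuous function. -/
theorem partialDeriv_ae_eq_rnDeriv
    (hf : IntegrableOn f (Ω : Set (EuclideanSpace ℝ (Fin n))) volume)
    (hμ : IsDistribPartialDeriv Ω f i μ) {g : EuclideanSpace ℝ (Fin n) → ℝ}
    (hgf : ∀ᵐ x ∂(volume.restrict (Ω : Set (EuclideanSpace ℝ (Fin n)))), g x = f x)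
    (hg : ∀ᵐ x ∂(volume.restrict (Ω : Set (EuclideanSpace ℝ (Fin n)))),
      PartialDerivExists g i x) :
    ∀ᵐ x ∂(volume.restrict (Ω : Set (EuclideanSpace ℝ (Fin n)))),
      partialDeriv g i x = μ.rnDeriv volume x := by
  have hu_int := SignedMeasure.integrable_rnDeriv μ volume
  have hum : Measurable (μ.rnDeriv volume) := SignedMeasure.measurable_rnDeriv μ volume
  -- the derivative is measurable as an almost everywhere limit of difference quotients
  have hdm : AEMeasurable (partialDeriv g i)
      (volume.restrict (Ω : Set (EuclideanSpace ℝ (Fin n)))) := by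
    have ht' : Tendsto (fun k : ℕ => 1 / ((k : ℝ) + 1)) atTop (𝓝[≠] 0) :=
      tendsto_nhdsWithin_iff.2 ⟨tendsto_one_div_add_atTop_nhds_zero_nat,
        Eventually.of_forall fun k => (Nat.one_div_pos_of_nat).ne'⟩
    exact aemeasurable_of_tendsto_metrizable_ae atTop
      (fun k => (integrable_diffQuotient hf _).1.aemeasurable.restrict)
      (ae_tendsto_diffQuotient hgf hg ht')
  have hle : ∀ ε : ℝ, 0 < ε →
      ∫⁻ x in (Ω : Set (EuclideanSpace ℝ (Fin n))), ‖partialDeriv g i x - μ.rnDeriv volume x‖ₑ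
        ≤ ENNReal.ofReal (3 * ε) := by
    intro ε hε
    obtain ⟨c, hcc, hcε, hc, hc_int⟩ := hu_int.exists_hasCompactSupport_integral_sub_le hε
    -- a compact null set `K` carries all but `ε` of the singular part
    obtain ⟨N, hNm, hN0, hNc⟩ := mutuallySingular_singularVariation μ volume
    obtain ⟨K, hKN, hK, hKε⟩ := hNm.compl.exists_isCompact_sdiff_lt
      (μ := singularVariation μ volume) (measure_ne_top _ _) (ε := ENNReal.ofReal ε) (by simpa)
    have hK0 : volume K = 0 := measure_mono_null hKN hNc
    set O : Set (EuclideanSpace ℝ (Fin n)) := Ω \ K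
    have hO : IsOpen O := Ω.isOpen.sdiff hK.isClosed
    have hOε : (singularVariation μ volume).real O ≤ ε := by
      refine ENNReal.toReal_le_of_le_ofReal hε.le ?_
      have hsub : O ⊆ N ∪ (Nᶜ \ K) := fun x hx => by
        by_cases hxN : x ∈ N
        · exact Or.inl hxN
        · exact Or.inr ⟨hxN, hx.2⟩
      refine (measure_mono hsub).trans ((measure_union_le _ _).trans ?_)
      rw [hN0, zero_add]
      exact hKε.le
    have hres : volume.restrict (Ω : Set (EuclideanSpace ℝ (Fin n))) = volume.restrict O :=
      Measure.restrict_congr_set (sdiff_null_ae_eq_self hK0).symm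
    rw [hres]
    calc ∫⁻ x in O, ‖partialDeriv g i x - μ.rnDeriv volume x‖ₑ
        ≤ ∫⁻ x in O, (‖partialDeriv g i x - c x‖ₑ + ‖μ.rnDeriv volume x - c x‖ₑ) :=
          lintegral_mono fun x => by
            have := enorm_sub_le (a := partialDeriv g i x - c x) (b := μ.rnDeriv volume x - c x)
            rwa [sub_sub_sub_cancel_right] at this
      _ = (∫⁻ x in O, ‖partialDeriv g i x - c x‖ₑ) + ∫⁻ x in O, ‖μ.rnDeriv volume x - c x‖ₑ :=
          lintegral_add_right _ (hum.sub hc.measurable).enorm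
      _ ≤ ENNReal.ofReal (ε + ε) + ENNReal.ofReal ε := by
          refine add_le_add ((lintegral_partialDeriv_sub_le hf hμ hgf hg hO sdiff_subset hc hcc).trans
            (ENNReal.ofReal_le_ofReal (add_le_add hcε hOε))) ?_
          refine (setLIntegral_le_lintegral _ _).trans ?_
          exact (ofReal_integral_norm_eq_lintegral_enorm (hu_int.sub hc_int)).symm.trans_le
            (ENNReal.ofReal_le_ofReal hcε)
      _ = ENNReal.ofReal (3 * ε) := by
          rw [← ENNReal.ofReal_add (by positivity) (by positivity)]
          congr 1
          ring
  have h0 : ∫⁻ x in (Ω : Set (EuclideanSpace ℝ (Fin n))),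
      ‖partialDeriv g i x - μ.rnDeriv volume x‖ₑ = 0 := by
    refine le_antisymm (ENNReal.le_of_forall_pos_le_add fun ε hε _ => ?_) zero_le
    have := hle (ε / 3) (by positivity)
    rw [mul_div_cancel₀ _ (by norm_num : (3 : ℝ) ≠ 0), ENNReal.ofReal_coe_nnreal] at this
    simpa using this
  filter_upwards [(lintegral_eq_zero_iff' (hdm.sub hum.aemeasurable).enorm).1 h0] with x hx
  simpa [sub_eq_zero] using hx

end DifferenceQuotient

end BVSpace

theorem mainTheorem8 (n : ℕ) (Ω : TopologicalSpace.Opens (EuclideanSpace ℝ (Fin n)))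
    (f : EuclideanSpace ℝ (Fin n) → ℝ) (hf : BVSpace.IsBV Ω f) :
    (∀ (i : Fin n) (g : EuclideanSpace ℝ (Fin n) → ℝ),
      (∀ᵐ x ∂(volume.restrict (Ω : Set (EuclideanSpace ℝ (Fin n)))), g x = f x) →
      (∀ᵐ x ∂(volume.restrict (Ω : Set (EuclideanSpace ℝ (Fin n)))),
        BVSpace.PartialDerivExists g i x) →
      ∀ᵐ x ∂(volume.restrict (Ω : Set (EuclideanSpace ℝ (Fin n)))),
        BVSpace.partialDeriv g i x = hf.acDensity x i) ∧
    (∀ g : EuclideanSpace ℝ (Fin n) → ℝ,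
      (∀ᵐ x ∂(volume.restrict (Ω : Set (EuclideanSpace ℝ (Fin n)))), g x = f x) →
      (∀ i : Fin n, ∀ᵐ x ∂(volume.restrict (Ω : Set (EuclideanSpace ℝ (Fin n)))),
        BVSpace.PartialDerivExists g i x) →
      ∀ᵐ x ∂(volume.restrict (Ω : Set (EuclideanSpace ℝ (Fin n)))),
        BVSpace.grad g x = hf.acDensity x) := by
  have key : ∀ (i : Fin n) (g : EuclideanSpace ℝ (Fin n) → ℝ),
      (∀ᵐ x ∂(volume.restrict (Ω : Set (EuclideanSpace ℝ (Fin n)))), g x = f x) →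
      (∀ᵐ x ∂(volume.restrict (Ω : Set (EuclideanSpace ℝ (Fin n)))),
        BVSpace.PartialDerivExists g i x) →
      ∀ᵐ x ∂(volume.restrict (Ω : Set (EuclideanSpace ℝ (Fin n)))),
        BVSpace.partialDeriv g i x = hf.acDensity x i := fun i g hgf hg =>
    BVSpace.partialDeriv_ae_eq_rnDeriv hf.integrableOn (hf.D_spec i) hgf hg
  refine ⟨key, fun g hgf hg => ?_⟩
  filter_upwards [ae_all_iff.2 fun i => key i g hgf (hg i)] with x hx
  ext i
  exact hx i
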